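/- \textbf{Definitions.} All Banach spaces are real. The density of a topological space is the least cardinality of a dense subset. For a set $X$ and $d\ge 1$, $[X]^d$ is the set of $d$-element subsets of $X$ and $[X]^{<\omega}$ is the set of finite subsets of $X$. For a cardinal $\kappa$ and an integer $d\ge 1$, the polarized partition principle $\mathrm{Pl}_d(\kappa)$ asserts that for every coloring $c:\big[[\kappa]^d\big]^{<\omega}\to\omega$ there is a sequence $(\mathbf{x}_n)_{n\in\omega}$ of pairwise disjoint infinite subsets of $\kappa$ such that for every $m\in\omega$ the coloring $c$ is constant on $\prod_{n=0}^m[\mathbf{x}_n]^d$, where a tuple $(s_0,\dots,s_m)$ in the product is identified with the finite set $\{s_0,\dots,s_m\}$. A Banach space contains $\ell_1$ if it has a subspace isomorphic (linearly homeomorphic) to $\ell_1$. A sequence $(x_n)_{n\in\omega}$ in a Banach space is basic if it is a Schauder basis of its closed linear span. For $C\ge 1$ it is $C$-unconditional if for all non-empty finite sets $F\subseteq G\subseteq\omega$ and all scalars $(a_n)_{n\in G}$, \[ \Big\|\sum_{n\in F}a_nx_n\Big\|\le C\,\Big\|\sum_{n\in G}a_nx_n\Big\|. \] \textbf{Theorem.}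 Let $\kappa$ be a cardinal such that $\mathrm{Pl}_2(\kappa)$ holds. Then every Banach space of density $\kappa$ that does not contain $\ell_1$ contains a $1$-unconditional basic sequence. In particular, if $E$ is any Banach space of density $\kappa$, then for every $\varepsilon>0$ the space $E$ contains a $(1+\varepsilon)$-unconditional basic sequence. -/

import Mathlib

universe u

/-- The density character of a topological space: the least cardinality of a dense subset. -/
noncomputable def densityCharacter (E : Type u) [TopologicalSpace E] : Cardinal.{u} :=
  sInf {c : Cardinal.{u} | ∃ s : Set E, Dense s ∧ Cardinal.mk s = c}

open Classical in
/-- The polarized partition principle `Pl_d(κ)` (for `d ≥ 1`): for every coloring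
`c : [[κ]^d]^{<ω} → ω` of the finite sets of `d`-element subsets of `κ` there are pairwise disjoint
infinite sets `x 0, x 1, … ⊆ κ` such that for every `m` the coloring `c` is constant on
`[x 0]^d × ⋯ × [x m]^d`, where a tuple `(s 0, …, s m)` in this product is identified
with the finite set `{s 0, …, s m}`. -/
def PolarizedPartition (d : ℕ) (κ : Cardinal.{u}) : Prop :=
  ∀ c : Finset (Set.powersetCard κ.out d) → ℕ,
    ∃ x : ℕ → Set κ.out,
      (∀ n, (x n).Infinite) ∧ (∀ i j, i ≠ j → Disjoint (x i) (x j)) ∧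
        ∀ m : ℕ, ∃ k : ℕ, ∀ s : Fin (m + 1) → Set.powersetCard κ.out d,
          (∀ n : Fin (m + 1), (((s n : Finset κ.out) : Set κ.out) ⊆ x n)) →
            c (Finset.univ.image s) = k

section BanachSpaces

variable {E : Type u} [NormedAddCommGroup E] [NormedSpace ℝ E]

/-- A sequence is basic if it is a Schauder basis of its closed linear span. -/
def IsBasicSequence (x : ℕ → E) : Prop :=
  ∃ b : SchauderBasis ℝ (Submodule.span ℝ (Set.range x)).topologicalClosure,
    ∀ n, (b n : E) = x n

/-- `x` is `C`-unconditional: `‖∑_{n ∈ F} a_n x_n‖ ≤ C ‖∑_{n ∈ G} a_n x_n‖` for all non-empty finite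
`F ⊆ G` and all scalars. -/
def IsUnconditionalWith (C : ℝ) (x : ℕ → E) : Prop :=
  ∀ F G : Finset ℕ, F.Nonempty → G.Nonempty → F ⊆ G → ∀ a : ℕ → ℝ,
    ‖∑ n ∈ F, a n • x n‖ ≤ C * ‖∑ n ∈ G, a n • x n‖

variable (E) in
/-- `E` contains a `C`-unconditional basic sequence. -/
def HasUnconditionalBasicSequence (C : ℝ) : Prop :=
  ∃ x : ℕ → E, IsBasicSequence x ∧ IsUnconditionalWith C x

variable (E) in
/-- `E` contains an isomorphic copy of `ℓ₁`: there is a bounded linear map `ℓ₁ → E` that is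
bounded below. -/
def ContainsEllOne : Prop :=
  ∃ T : lp (fun _ : ℕ => ℝ) 1 →L[ℝ] E, ∃ δ : ℝ, 0 < δ ∧ ∀ v, δ * ‖v‖ ≤ ‖T v‖

end BanachSpaces

/-!
Choose bounded, pairwise distinct vectors `e a` in `E`, and put `z t = e p - e q` for two distinct
elements `p`, `q` of the `d`-element set `t`. Colour a finite set of `d`-element sets by a rational
witness of the failure, by more than `1`, of `1`-unconditionality of the corresponding vectors
`z t`, if there is one. On each product of sets `[x i]^d` given by the partition principle, the
witness is one and the same. But no witness survives on a whole product. Keep the chosen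
`t ∈ [x i]^d` for `i` in the subset named by the witness, and take a norming functional `f` of their
combination; as `e` is bounded, the pigeonhole principle provides for every other `i` some
`t ∈ [x i]^d` with `f (z t)` nearly zero. After these replacements the norm of the whole sum is, up
to a small error, at least that of the kept part. So there is no witness at all, and homogeneity
turns the error `1` into `0`.

A finite set of `d`-element sets forgets which of them came from which `x i`, whereas a witness
refers to indices. To recover them, fix a linear order and also colour by whether the `d`-element
sets form blocks, each lying entirely below or above every other. Every product of infinite sets
contains such a tuple of blocks, so all its tuples are of this kind; since `2 ≤ d`, the sets `x i`
themselves are then blocks, and the position of `t` among the other blocks determines `i`.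
-/

section BasicSequences

variable {E : Type*} [NormedAddCommGroup E] [NormedSpace ℝ E] {C D : ℝ} {x : ℕ → E}

/-- Grünblum's condition: the partial sums of a finite linear combination of `x` are bounded by `C`
times the whole combination. It is the criterion by which a sequence of non-zero vectors is shown to
be basic. -/
def HasBasisConstant (C : ℝ) (x : ℕ → E) : Prop :=
  ∀ (a : ℕ → ℝ) (m n : ℕ), m ≤ n →
    ‖∑ i ∈ Finset.range m, a i • x i‖ ≤ C * ‖∑ i ∈ Finset.range n, a i • x i‖

/-- The linear map `l ↦ ∑ n, l n • x n` on finitely supported scalar sequences, with values in the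
closed linear span of `x`, where its range is dense. -/
noncomputable def finsuppToClosedSpan (x : ℕ → E) :
    (ℕ →₀ ℝ) →ₗ[ℝ] (Submodule.span ℝ (Set.range x)).topologicalClosure :=
  (Finsupp.linearCombination ℝ x).codRestrict _ fun l =>
    Submodule.le_topologicalClosure _
      (Finsupp.range_linearCombination ℝ (v := x) ▸ LinearMap.mem_range_self _ l)

theorem coe_finsuppToClosedSpan_single (x : ℕ → E) (n : ℕ) :
    (finsuppToClosedSpan x (Finsupp.single n 1) : E) = x n := by
  simp [finsuppToClosedSpan]

theorem coe_finsuppToClosedSpan_eq_sum_range (x : ℕ → E) {l : ℕ →₀ ℝ} {N : ℕ}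
    (hN : l.support ⊆ Finset.range N) :
    (finsuppToClosedSpan x l : E) = ∑ n ∈ Finset.range N, l n • x n := by
  change Finsupp.linearCombination ℝ x l = _
  rw [Finsupp.linearCombination_apply, Finsupp.sum_of_support_subset l hN _ (by simp)]

theorem denseRange_finsuppToClosedSpan (x : ℕ → E) : DenseRange (finsuppToClosedSpan x) := by
  intro y
  have himage : ((↑) '' Set.range (finsuppToClosedSpan x) : Set E) =
      Submodule.span ℝ (Set.range x) := by
    rw [← Set.range_comp]
    exact congrArg SetLike.coe (Finsupp.range_linearCombination ℝ (v := x))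
  rw [closure_subtype, himage, ← Submodule.topologicalClosure_coe]
  exact y.2

namespace HasBasisConstant

theorem norm_sum_range_le (hC : HasBasisConstant C x) (l : ℕ →₀ ℝ) (m : ℕ) :
    ‖∑ n ∈ Finset.range m, l n • x n‖ ≤ C * ‖finsuppToClosedSpan x l‖ := by
  obtain ⟨N, hN⟩ := l.support.exists_nat_subset_range
  rw [Submodule.coe_norm, coe_finsuppToClosedSpan_eq_sum_range x
    (hN.trans (Finset.range_mono (le_max_right m N)))]
  exact hC l m _ (le_max_left m N)

theorem abs_apply_le (hC : HasBasisConstant C x) (hx : ∀ n, x n ≠ 0) (l : ℕ →₀ ℝ) (n : ℕ) :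
    |l n| ≤ 2 * C / ‖x n‖ * ‖finsuppToClosedSpan x l‖ := by
  rw [div_mul_eq_mul_div, le_div_iff₀ (norm_pos_iff.2 (hx n))]
  calc |l n| * ‖x n‖
      = ‖∑ i ∈ Finset.range (n + 1), l i • x i - ∑ i ∈ Finset.range n, l i • x i‖ := by
        rw [Finset.sum_range_succ_sub_sum, norm_smul, Real.norm_eq_abs]
    _ ≤ C * ‖finsuppToClosedSpan x l‖ + C * ‖finsuppToClosedSpan x l‖ :=
        (norm_sub_le _ _).trans
          (add_le_add (hC.norm_sum_range_le l (n + 1)) (hC.norm_sum_range_le l n))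
    _ = 2 * C * ‖finsuppToClosedSpan x l‖ := by ring

theorem exists_coord (hC : HasBasisConstant C x) (hx : ∀ n, x n ≠ 0) (n : ℕ) :
    ∃ f : StrongDual ℝ (Submodule.span ℝ (Set.range x)).topologicalClosure,
      ∀ l, f (finsuppToClosedSpan x l) = l n :=
  ⟨(Finsupp.lapply n : (ℕ →₀ ℝ) →ₗ[ℝ] ℝ).extendOfNorm (finsuppToClosedSpan x),
    LinearMap.extendOfNorm_eq (denseRange_finsuppToClosedSpan x)
      ⟨2 * C / ‖x n‖, fun l => hC.abs_apply_le hx l n⟩⟩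

theorem isBasicSequence (hC : HasBasisConstant C x) (hx : ∀ n, x n ≠ 0) : IsBasicSequence x := by
  set T := finsuppToClosedSpan x with hT
  have hdense : DenseRange T := denseRange_finsuppToClosedSpan x
  choose coord hcoord using hC.exists_coord hx
  let b : ℕ → (Submodule.span ℝ (Set.range x)).topologicalClosure := fun n => T (Finsupp.single n 1)
  have hb : ∀ n, (b n : E) = x n := coe_finsuppToClosedSpan_single x
  let P := fun n => ∑ i ∈ Finset.range n, (coord i).smulRight (b i)
  have hP : ∀ n v, P n v = ∑ i ∈ Finset.range n, coord i v • b i := fun n v => by simp [P]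
  have hPT : ∀ n l, (P n (T l) : E) = ∑ i ∈ Finset.range n, l i • x i := fun n l => by
    simp [hP, hT, hcoord, hb]
  have hbound : ∀ n v, ‖P n v‖ ≤ C * ‖v‖ := fun n v => by
    refine hdense.induction_on v (isClosed_le (by fun_prop) (by fun_prop)) fun l => ?_
    rw [Submodule.coe_norm, hPT]
    exact hC.norm_sum_range_le l n
  have hequicontinuous : Equicontinuous fun n v => P n v :=
    (show (∃ C, ∀ n v, ‖P n v‖ ≤ C * ‖v‖) ↔ _ from
      (NormedSpace.equicontinuous_TFAE P).out 3 1).1 ⟨C, hbound⟩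
  have hclosed : IsClosed {v | Filter.Tendsto (fun n => P n v) Filter.atTop (nhds v)} :=
    hequicontinuous.isClosed_setOfPred_tendsto continuous_id
  have htendsto : ∀ v, Filter.Tendsto (fun n => P n v) Filter.atTop (nhds v) := fun v => by
    refine hdense.induction_on v hclosed fun l => ?_
    obtain ⟨N, hN⟩ := l.support.exists_nat_subset_range
    refine tendsto_atTop_of_eventually_const (i₀ := N) fun n hn => Subtype.ext ?_
    rw [hPT, hT, coe_finsuppToClosedSpan_eq_sum_range x (hN.trans (Finset.range_mono hn))]
  refine ⟨⟨b, coord, fun i j => ?_, fun v => ?_⟩, hb⟩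
  · have hij : coord i (b j) = Finsupp.single j 1 i := hcoord i _
    rw [hij]
    simp [Finsupp.single_apply, Pi.single_apply, eq_comm]
  · rw [HasSum, SummationFilter.conditional_filter_eq_map_range, Filter.tendsto_map'_iff]
    exact (htendsto v).congr fun n => hP n v

end HasBasisConstant

theorem IsUnconditionalWith.mono (hC : IsUnconditionalWith C x) (hCD : C ≤ D) :
    IsUnconditionalWith D x := fun F G hF hG hFG a =>
  (hC F G hF hG hFG a).trans (mul_le_mul_of_nonneg_right hCD (norm_nonneg _))

theorem HasUnconditionalBasicSequence.mono (hC : HasUnconditionalBasicSequence E C) (hCD : C ≤ D) :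
    HasUnconditionalBasicSequence E D :=
  let ⟨x, hbasic, hx⟩ := hC
  ⟨x, hbasic, hx.mono hCD⟩

theorem IsUnconditionalWith.nonneg (hC : IsUnconditionalWith C x) (hx : ∀ n, x n ≠ 0) : 0 ≤ C := by
  have h : ‖x 0‖ ≤ C * ‖x 0‖ := by simpa using hC {0} {0} (by simp) (by simp) subset_rfl 1
  nlinarith [norm_pos_iff.2 (hx 0)]

theorem IsUnconditionalWith.hasBasisConstant (hC : IsUnconditionalWith C x) (hx : ∀ n, x n ≠ 0) :
    HasBasisConstant C x := by
  intro a m n hmn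
  rcases m.eq_zero_or_pos with rfl | hm
  · simpa using mul_nonneg (hC.nonneg hx) (norm_nonneg _)
  · exact hC _ _ (Finset.nonempty_range_iff.2 hm.ne')
      (Finset.nonempty_range_iff.2 (hm.trans_le hmn).ne') (Finset.range_mono hmn) a

theorem isUnconditionalWith_of_forall_fin
    (h : ∀ (m : ℕ) (F : Finset (Fin (m + 1))) (a : Fin (m + 1) → ℝ),
      ‖∑ i ∈ F, a i • x i‖ ≤ C * ‖∑ i, a i • x i‖) :
    IsUnconditionalWith C x := by
  intro F G _ _ hFG a
  obtain ⟨m, hm⟩ := G.exists_nat_subset_range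
  have hsum : ∀ H ⊆ G, ∑ i ∈ Finset.univ.filter fun i : Fin (m + 1) => (i : ℕ) ∈ H,
      (if (i : ℕ) ∈ G then a i else 0) • x i = ∑ n ∈ H, a n • x n := by
    intro H hHG
    rw [Finset.sum_filter, Fin.sum_univ_eq_sum_range
        (fun n => if n ∈ H then (if n ∈ G then a n else 0) • x n else 0), ← Finset.sum_filter,
      Finset.filter_mem_eq_inter, Finset.inter_eq_right.2
        ((hHG.trans hm).trans (Finset.range_mono m.le_succ))]
    exact Finset.sum_congr rfl fun n hn => by rw [if_pos (hHG hn)]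
  have hG : ∑ i ∈ Finset.univ.filter fun i : Fin (m + 1) => (i : ℕ) ∈ G,
      (if (i : ℕ) ∈ G then a i else 0) • x i =
      ∑ i : Fin (m + 1), (if (i : ℕ) ∈ G then a i else 0) • x i :=
    Finset.sum_filter_of_ne fun i _ hi => by
      by_contra hiG
      simp [hiG] at hi
  rw [← hsum F hFG, ← hsum G subset_rfl, hG]
  exact h m _ _

end BasicSequences

section Blocks

open Finset

variable {I : Type*} {d : ℕ}

theorem exists_powersetCard_between {X : Set I} (hX : X.Infinite) {A : Finset I} (hAX : ↑A ⊆ X)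
    (hA : #A ≤ d) : ∃ s : Set.powersetCard I d, A ⊆ (s : Finset I) ∧ (s : Set I) ⊆ X := by
  classical
  obtain ⟨B, hBX, hB⟩ := (hX.sdiff A.finite_toSet).exists_subset_card_eq (d - #A)
  have hAB : Disjoint A B := disjoint_left.2 fun a haA haB => (hBX haB).2 haA
  refine ⟨⟨A ∪ B, ?_⟩, subset_union_left, ?_⟩
  · rw [Set.powersetCard.mem_iff, card_union_of_disjoint hAB, hB, Nat.add_sub_cancel' hA]
  · change ((A ∪ B : Finset I) : Set I) ⊆ X
    rw [coe_union]
    exact Set.union_subset hAX (hBX.trans Set.sdiff_subset)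

section Selections

variable {ι : Type*} {x : ι → Set I} {s : ι → Set.powersetCard I d}

/-- The product `∏ i, [x i]^d` of the polarized partition principle, as a set of tuples. -/
def selections (d : ℕ) (x : ι → Set I) : Set (ι → Set.powersetCard I d) :=
  {s | ∀ i, (s i : Set I) ⊆ x i}

theorem nonempty_selections (d : ℕ) (hx : ∀ i, (x i).Infinite) : (selections d x).Nonempty := by
  choose s _ hs using fun i =>
    exists_powersetCard_between (hx i) (A := ∅) (d := d) (by simp) (by simp)
  exact ⟨s, hs⟩

theorem update_mem_selections [DecidableEq ι] (hs : s ∈ selections d x) {i : ι}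
    {t : Set.powersetCard I d} (ht : (t : Set I) ⊆ x i) :
    Function.update s i t ∈ selections d x := fun j => by
  rcases eq_or_ne j i with rfl | hji
  · rwa [Function.update_self]
  · rw [Function.update_of_ne hji]
    exact hs j

theorem nonempty_coe_powersetCard (hd : 0 < d) (t : Set.powersetCard I d) : (t : Set I).Nonempty :=
  Set.powersetCard.coe_nonempty_iff.2 hd

theorem injective_of_mem_selections (hd : 0 < d) (hx : Pairwise (Function.onFun Disjoint x))
    (hs : s ∈ selections d x) : Function.Injective s := by
  intro i j hij
  by_contra hne
  obtain ⟨a, ha⟩ := nonempty_coe_powersetCard hd (s i)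
  exact Set.disjoint_left.1 (hx hne) (hs i ha) (hs j (hij ▸ ha))

end Selections

section Precedes

variable [Preorder I] {A A' B B' C : Set I}

/-- `A` lies entirely below `B`: the order in which blocks are listed. -/
def Precedes (A B : Set I) : Prop :=
  ∀ a ∈ A, ∀ b ∈ B, a < b

/-- `A` and `B` are comparable as blocks: one of them lies entirely below the other. -/
def Separated (A B : Set I) : Prop :=
  Precedes A B ∨ Precedes B A

theorem Precedes.mono (h : Precedes A B) (hA : A' ⊆ A) (hB : B' ⊆ B) : Precedes A' B' :=
  fun a ha b hb => h a (hA ha) b (hB hb)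

theorem Precedes.trans (hAB : Precedes A B) (hBC : Precedes B C) (hB : B.Nonempty) :
    Precedes A C := fun a ha c hc =>
  let ⟨b, hb⟩ := hB
  (hAB a ha b hb).trans (hBC b hb c hc)

theorem not_precedes_self (hA : A.Nonempty) : ¬Precedes A A := fun h =>
  let ⟨a, ha⟩ := hA
  (h a ha a ha).false

theorem Separated.precedes_iff_of_subset (h : Separated A B) (hA : A' ⊆ A) (hB : B' ⊆ B)
    (hA' : A'.Nonempty) (hB' : B'.Nonempty) : Precedes A' B' ↔ Precedes A B :=
  ⟨fun h' => h.resolve_right fun hBA =>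
    not_precedes_self hA' (h'.trans (hBA.mono hB hA) hB'), fun h' => h'.mono hA hB⟩

theorem Separated.disjoint (h : Separated A B) : Disjoint A B :=
  Set.disjoint_left.2 fun a ha hb => h.elim (fun h => (h a ha a hb).false) fun h =>
    (h a hb a ha).false

/-- A set of `d`-element subsets that are pairwise separated, hence linearly ordered as blocks. -/
def IsBlockFamily (S : Set (Set.powersetCard I d)) : Prop :=
  S.Pairwise fun s t => Separated (s : Set I) t

end Precedes

section Greedy

variable [LinearOrder I] {ι : Type*} {x : ι → Set I} {A B : Set I}

theorem exists_cut_of_le_card {x : ι → Finset I} {J : Finset ι} (hd : 0 < d)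
    (hJ : J.Nonempty) (hx : ∀ i ∈ J, d ≤ #(x i)) :
    ∃ b, (∃ j ∈ J, d ≤ #{a ∈ x j | a ≤ b}) ∧ ∀ i ∈ J, #{a ∈ x i | a < b} < d := by
  classical
  let cuts : Finset I := {b ∈ J.biUnion x | ∃ j ∈ J, d ≤ #{a ∈ x j | a ≤ b}}
  have mem_cuts {b : I} {i : ι} (hi : i ∈ J) (hb : b ∈ x i) (hcard : d ≤ #{a ∈ x i | a ≤ b}) :
      b ∈ cuts :=
    mem_filter.2 ⟨mem_biUnion.2 ⟨i, hi, hb⟩, i, hi, hcard⟩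
  have hcuts : cuts.Nonempty := by
    obtain ⟨i, hi⟩ := hJ
    have hne : (x i).Nonempty := card_pos.1 (hd.trans_le (hx i hi))
    refine ⟨(x i).max' hne, mem_cuts hi (max'_mem _ _) ?_⟩
    rw [filter_true_of_mem fun a ha => le_max' _ a ha]
    exact hx i hi
  obtain ⟨b, hb, hmin⟩ := cuts.exists_minimal hcuts
  refine ⟨b, (mem_filter.1 hb).2, fun i hi => ?_⟩
  by_contra! hcard
  have hne : {a ∈ x i | a < b}.Nonempty := card_pos.1 (hd.trans_le hcard)
  obtain ⟨hmem, hlt⟩ := mem_filter.1 (max'_mem _ hne)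
  refine (hmin (mem_cuts hi hmem (hcard.trans (card_le_card fun a ha => ?_))) hlt.le).not_gt hlt
  exact mem_filter.2 ⟨(mem_filter.1 ha).1, le_max' _ a ha⟩

theorem card_le_card_filter_lt_add {X : Finset I} {b : I} (hb : #{a ∈ X | a < b} < d) :
    #X ≤ #{a ∈ X | b < a} + d := by
  have hsub : {a ∈ X | ¬b < a} ⊆ insert b {a ∈ X | a < b} := fun a ha => by
    simp only [mem_filter, mem_insert, not_lt, le_iff_eq_or_lt] at ha ⊢
    tauto
  rw [← card_filter_add_card_filter_not (s := X) (b < ·)]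
  exact Nat.add_le_add_left ((card_le_card hsub).trans ((card_insert_le _ _).trans hb)) _

theorem exists_separated_subsets (hd : 0 < d) (J : Finset ι) (x : ι → Finset I)
    (hx : ∀ i ∈ J, #J * d ≤ #(x i)) :
    ∃ s : ι → Finset I, (∀ i ∈ J, s i ⊆ x i ∧ #(s i) = d) ∧
      (J : Set ι).Pairwise fun i j => Separated (s i : Set I) (s j) := by
  classical
  induction hn : #J generalizing J x with
  | zero => exact ⟨fun _ => ∅, by simp [card_eq_zero.1 hn]⟩
  | succ n ih =>
    rw [hn] at hx
    have hJ : J.Nonempty := card_pos.1 (by omega)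
    obtain ⟨b, ⟨j, hj, hjb⟩, hb⟩ := exists_cut_of_le_card hd hJ fun i hi =>
      (Nat.le_mul_of_pos_left d n.succ_pos).trans (hx i hi)
    obtain ⟨t, ht, htd⟩ := exists_subset_card_eq hjb
    have hcard : #(J.erase j) = n := by rw [card_erase_of_mem hj, hn, Nat.add_sub_cancel]
    have htail : ∀ i ∈ J.erase j, #(J.erase j) * d ≤ #{a ∈ x i | b < a} := by
      intro i hi
      have hle := card_le_card_filter_lt_add (hb i (mem_of_mem_erase hi))
      rw [hcard]
      linarith [hx i (mem_of_mem_erase hi), add_mul n 1 d]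
    obtain ⟨s, hs, hsep⟩ := ih (J.erase j) (fun i => {a ∈ x i | b < a}) htail hcard
    have hprec : ∀ i ∈ J.erase j, Precedes (t : Set I) (s i) := fun i hi a ha c hc =>
      (mem_filter.1 (ht ha)).2.trans_lt (mem_filter.1 ((hs i hi).1 hc)).2
    refine ⟨Function.update s j t, fun i hi => ?_, fun i hi k hk hik => ?_⟩
    · rcases eq_or_ne i j with rfl | hij
      · rw [Function.update_self]
        exact ⟨ht.trans (filter_subset _ _), htd⟩
      · rw [Function.update_of_ne hij]
        exact (hs i (mem_erase.2 ⟨hij, hi⟩)).imp_left fun h => h.trans (filter_subset _ _)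
    · rcases eq_or_ne i j with rfl | hij
      · rw [Function.update_self, Function.update_of_ne hik.symm]
        exact .inl (hprec k (mem_erase.2 ⟨hik.symm, hk⟩))
      rcases eq_or_ne k j with rfl | hkj
      · rw [Function.update_self, Function.update_of_ne hik]
        exact .inr (hprec i (mem_erase.2 ⟨hik, hi⟩))
      rw [Function.update_of_ne hij, Function.update_of_ne hkj]
      exact hsep (mem_erase.2 ⟨hij, hi⟩) (mem_erase.2 ⟨hkj, hk⟩) hik

theorem exists_mem_selections_isBlockFamily [Finite ι] (hd : 0 < d) (hx : ∀ i, (x i).Infinite) :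
    ∃ s ∈ selections d x, IsBlockFamily (Set.range s) := by
  cases nonempty_fintype ι
  choose y hyx hy using fun i => (hx i).exists_subset_card_eq (#(univ : Finset ι) * d)
  obtain ⟨s, hs, hsep⟩ := exists_separated_subsets hd univ y fun i _ => (hy i).ge
  refine ⟨fun i => ⟨s i, (hs i (mem_univ i)).2⟩, fun i => ?_, ?_⟩
  · exact (coe_subset.2 (hs i (mem_univ i)).1).trans (hyx i)
  · rintro _ ⟨i, rfl⟩ _ ⟨j, rfl⟩ hij
    exact hsep (by simp) (by simp) fun h => hij (h ▸ rfl)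

theorem separated_of_forall_powersetCard (hd : 2 ≤ d) (hA : A.Infinite) (hB : B.Infinite)
    (h : ∀ s t : Set.powersetCard I d, (s : Set I) ⊆ A → (t : Set I) ⊆ B →
      Separated (s : Set I) t) : Separated A B := by
  by_contra hAB
  simp only [Separated, Precedes, not_or, not_forall, not_lt] at hAB
  obtain ⟨⟨a, ha, b, hb, hba⟩, b', hb', a', ha', hab⟩ := hAB
  obtain ⟨s, hs, hsA⟩ := exists_powersetCard_between hA (A := {a, a'})
    (by simp [Set.insert_subset_iff, ha, ha']) (card_le_two.trans hd)
  obtain ⟨t, ht, htB⟩ := exists_powersetCard_between hB (A := {b, b'})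
    (by simp [Set.insert_subset_iff, hb, hb']) (card_le_two.trans hd)
  rcases h s t hsA htB with hst | hts
  · exact (hst a (hs (by simp)) b (ht (by simp))).not_ge hba
  · exact (hts b' (ht (by simp)) a' (hs (by simp))).not_ge hab

theorem pairwise_separated_of_forall_isBlockFamily (hd : 2 ≤ d) (hx : ∀ i, (x i).Infinite)
    (hdisj : Pairwise (Function.onFun Disjoint x))
    (hblock : ∀ s ∈ selections d x, IsBlockFamily (Set.range s)) :
    Pairwise (Function.onFun Separated x) := by
  classical
  intro i j hij
  refine separated_of_forall_powersetCard hd (hx i) (hx j) fun t u ht hu => ?_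
  obtain ⟨r, hr⟩ := nonempty_selections d hx
  set s := Function.update (Function.update r i t) j u
  have hs : s ∈ selections d x := update_mem_selections (update_mem_selections hr ht) hu
  have hsi : s i = t := (Function.update_of_ne hij ..).trans (Function.update_self ..)
  have hsj : s j = u := Function.update_self ..
  rw [← hsi, ← hsj]
  exact hblock s hs ⟨i, rfl⟩ ⟨j, rfl⟩ ((injective_of_mem_selections (by omega) hdisj hs).ne hij)

end Greedy

section NumPreceding

variable [Preorder I] {ι κ : Type*} {y y' : ι → Set I}

open Classical in
/-- The number of `j ∈ S` such that `y j` precedes `y i`: the position of `y i`, counted from `0`,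
when the blocks `y j` are listed in increasing order. -/
noncomputable def numPreceding (y : ι → Set I) (S : Finset ι) (i : ι) : ℕ :=
  #{j ∈ S | Precedes (y j) (y i)}

theorem numPreceding_image [DecidableEq ι] {f : κ → ι} (hf : Function.Injective f) (y : ι → Set I)
    (S : Finset κ) (k : κ) : numPreceding y (S.image f) (f k) = numPreceding (y ∘ f) S k := by
  classical
  rw [numPreceding, filter_image, card_image_of_injective _ hf]
  rfl

theorem numPreceding_eq_of_subset (hy : Pairwise (Function.onFun Separated y))
    (hy'y : ∀ i, y' i ⊆ y i) (hy' : ∀ i, (y' i).Nonempty) (S : Finset ι) :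
    numPreceding y' S = numPreceding y S := by
  classical
  funext i
  refine congrArg card (filter_congr fun j _ => ?_)
  rcases eq_or_ne j i with rfl | hji
  · exact iff_of_false (not_precedes_self (hy' j)) (not_precedes_self ((hy' j).mono (hy'y j)))
  · exact (hy hji).precedes_iff_of_subset (hy'y j) (hy'y i) (hy' j) (hy' i)

theorem Precedes.numPreceding_lt {S : Finset ι} {i j : ι} (hij : Precedes (y i) (y j)) (hi : i ∈ S)
    (hy : (y i).Nonempty) : numPreceding y S i < numPreceding y S j := by
  classical
  refine card_lt_card (ssubset_iff.2 ⟨i, ?_, insert_subset ?_ fun k hk => ?_⟩)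
  · simp [not_precedes_self hy]
  · simp [hi, hij]
  · rw [mem_filter] at hk ⊢
    exact ⟨hk.1, hk.2.trans hij hy⟩

theorem injective_numPreceding [Fintype ι] (hy : ∀ i, (y i).Nonempty)
    (hsep : Pairwise (Function.onFun Separated y)) : Function.Injective (numPreceding y univ) := by
  intro i j hij
  by_contra hne
  rcases hsep hne with h | h
  · exact (h.numPreceding_lt (mem_univ i) (hy i)).ne hij
  · exact (h.numPreceding_lt (mem_univ j) (hy j)).ne' hij

theorem numPreceding_image_selection [Fintype ι] [DecidableEq (Set.powersetCard I d)] (hd : 0 < d)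
    {x : ι → Set I} (hsep : Pairwise (Function.onFun Separated x))
    {s : ι → Set.powersetCard I d} (hs : s ∈ selections d x) (i : ι) :
    numPreceding (fun t : Set.powersetCard I d => (t : Set I)) (univ.image s) (s i) =
      numPreceding x univ i := by
  have hne : ∀ i, (s i : Set I).Nonempty := fun i => nonempty_coe_powersetCard hd (s i)
  have hinj : Function.Injective s :=
    injective_of_mem_selections hd (hsep.mono fun _ _ => Separated.disjoint) hs
  rw [numPreceding_image hinj]
  exact congrFun (numPreceding_eq_of_subset hsep hs hne _) i

end NumPreceding

end Blocks

section NormEstimates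

variable {V E F ι : Type*} [AddCommGroup V] [Module ℝ V] [SeminormedAddCommGroup E]
  [NormedSpace ℝ E] [SeminormedAddCommGroup F] [NormedSpace ℝ F]

theorem norm_le_norm_of_forall_norm_le_add {L : V →ₗ[ℝ] E} {M : V →ₗ[ℝ] F} {C : ℝ}
    (h : ∀ v, ‖L v‖ ≤ ‖M v‖ + C) (v : V) : ‖L v‖ ≤ ‖M v‖ := by
  by_contra! hlt
  obtain ⟨n, hn⟩ := exists_lt_nsmul (sub_pos.2 hlt) C
  have hnv := h ((n : ℝ) • v)
  rw [map_smul, map_smul, norm_smul, norm_smul, Real.norm_natCast] at hnv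
  rw [nsmul_eq_mul] at hn
  linarith

theorem norm_sum_le_norm_sum_of_forall_rat [Fintype ι] {v : ι → E} {G : Finset ι} {C : ℝ}
    (h : ∀ a : ι → ℚ, ‖∑ i ∈ G, (a i : ℝ) • v i‖ ≤ ‖∑ i, (a i : ℝ) • v i‖ + C) (a : ι → ℝ) :
    ‖∑ i ∈ G, a i • v i‖ ≤ ‖∑ i, a i • v i‖ := by
  have hreal : ∀ a : ι → ℝ, ‖∑ i ∈ G, a i • v i‖ ≤ ‖∑ i, a i • v i‖ + C := fun a => by
    have hdense : DenseRange (Pi.map fun (_ : ι) (q : ℚ) => (q : ℝ)) :=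
      DenseRange.piMap fun _ => Rat.denseRange_cast
    exact hdense.induction_on a (isClosed_le (by fun_prop) (by fun_prop)) h
  let partialSum (H : Finset ι) : (ι → ℝ) →ₗ[ℝ] E := ∑ i ∈ H, (LinearMap.proj i).smulRight (v i)
  have hpartialSum : ∀ H a, partialSum H a = ∑ i ∈ H, a i • v i := fun H a => by
    simp [partialSum]
  simp only [← hpartialSum] at hreal ⊢
  exact norm_le_norm_of_forall_norm_le_add hreal a

end NormEstimates

section Coloring

variable {I : Type*} {d : ℕ} {E : Type*} [NormedAddCommGroup E] [NormedSpace ℝ E]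
  {z : Set.powersetCard I d → E} {ι : Type*} {x : ι → Set I}

/-- Every functional is arbitrarily small at `z t` for some `d`-element subset `t` of any prescribed
infinite set. This plays the role of weak convergence to zero. -/
def IsWeaklySmall (z : Set.powersetCard I d → E) : Prop :=
  ∀ (f : StrongDual ℝ E) (X : Set I), X.Infinite → ∀ δ > 0,
    ∃ t : Set.powersetCard I d, (t : Set I) ⊆ X ∧ |f (z t)| < δ

namespace IsWeaklySmall

theorem exists_mem_selections_abs_apply_sum_le [Finite ι] (hz : IsWeaklySmall z)
    (hx : ∀ i, (x i).Infinite) (f : StrongDual ℝ E) (a : ι → ℝ) {ε : ℝ} (hε : 0 < ε) :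
    ∃ s ∈ selections d x, ∀ G : Finset ι, |f (∑ i ∈ G, a i • z (s i))| ≤ ε := by
  cases nonempty_fintype ι
  set A := ∑ i, |a i|
  have hA : 0 < A + 1 :=
    add_pos_of_nonneg_of_pos (Finset.sum_nonneg fun i _ => abs_nonneg _) one_pos
  choose s hs hsmall using fun i => hz f (x i) (hx i) (ε / (A + 1)) (div_pos hε hA)
  refine ⟨s, hs, fun G => ?_⟩
  rw [map_sum]
  calc |∑ i ∈ G, f (a i • z (s i))|
      ≤ ∑ i ∈ G, |f (a i • z (s i))| := Finset.abs_sum_le_sum_abs _ _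
    _ ≤ ∑ i, |f (a i • z (s i))| := Finset.sum_le_univ_sum_of_nonneg fun i => abs_nonneg _
    _ ≤ ∑ i, |a i| * (ε / (A + 1)) := Finset.sum_le_sum fun i _ => by
        rw [map_smul, smul_eq_mul, abs_mul]
        exact mul_le_mul_of_nonneg_left (hsmall i).le (abs_nonneg _)
    _ = A / (A + 1) * ε := by rw [← Finset.sum_mul]; ring
    _ ≤ ε := mul_le_of_le_one_left hε.le ((div_le_one hA).2 (by linarith))

theorem exists_mem_selections_norm_sum_le [Fintype ι] (hz : IsWeaklySmall z)
    (hx : ∀ i, (x i).Infinite) (a : ι → ℝ) (G : Finset ι) {ε : ℝ} (hε : 0 < ε) :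
    ∃ s ∈ selections d x, ‖∑ i ∈ G, a i • z (s i)‖ ≤ ‖∑ i, a i • z (s i)‖ + ε := by
  classical
  obtain ⟨r, hr⟩ := nonempty_selections d hx
  obtain ⟨f, hf, hnorming⟩ := exists_dual_vector'' ℝ (∑ i ∈ G, a i • z (r i))
  rw [RCLike.ofReal_real_eq_id, id] at hnorming
  obtain ⟨q, hq, hsmall⟩ := hz.exists_mem_selections_abs_apply_sum_le hx f a hε
  refine ⟨G.piecewise r q, fun i => ?_, ?_⟩
  · exact G.piecewise_cases r q (fun t => (t : Set I) ⊆ x i) (hr i) (hq i)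
  have hG : ∑ i ∈ G, a i • z (G.piecewise r q i) = ∑ i ∈ G, a i • z (r i) :=
    Finset.sum_congr rfl fun i hi => by rw [G.piecewise_eq_of_mem _ _ hi]
  have hcompl : ∑ i ∈ Gᶜ, a i • z (G.piecewise r q i) = ∑ i ∈ Gᶜ, a i • z (q i) :=
    Finset.sum_congr rfl fun i hi => by
      rw [G.piecewise_eq_of_notMem _ _ (Finset.mem_compl.1 hi)]
  rw [← Finset.sum_add_sum_compl G, hG, hcompl, ← hnorming]
  calc f (∑ i ∈ G, a i • z (r i))
      = f (∑ i ∈ G, a i • z (r i) + ∑ i ∈ Gᶜ, a i • z (q i)) -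
          f (∑ i ∈ Gᶜ, a i • z (q i)) := by rw [map_add, add_sub_cancel_right]
    _ ≤ ‖∑ i ∈ G, a i • z (r i) + ∑ i ∈ Gᶜ, a i • z (q i)‖ + ε := by
        rw [sub_eq_add_neg]
        exact add_le_add ((le_abs_self _).trans (f.le_of_opNorm_le_of_le hf le_rfl |>.trans
          (one_mul _).le)) ((neg_le_abs _).trans (hsmall _))

end IsWeaklySmall

section Violates

variable [Preorder I]

/-- The vectors `z t` for `t ∈ S` violate `1`-unconditionality by more than `1`, as witnessed by the
coefficients `w.1` and the subset `w.2`. Both refer to the positions of the blocks `t` in `S`, so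
that one witness makes sense for all block families. -/
def Violates (z : Set.powersetCard I d → E) (S : Finset (Set.powersetCard I d))
    (w : (ℕ →₀ ℚ) × Finset ℕ) : Prop :=
  let pos := numPreceding (fun t : Set.powersetCard I d => (t : Set I)) S
  ‖∑ t ∈ S, (w.1 (pos t) : ℝ) • z t‖ + 1 < ‖∑ t ∈ S with pos t ∈ w.2, (w.1 (pos t) : ℝ) • z t‖

/-- The obstructions for which finite sets of `d`-element sets are coloured: `none` stands for not
being a block family, `some w` for being a block family that violates `1`-unconditionality as
witnessed by `w`. -/
def IsObstruction (z : Set.powersetCard I d → E) (S : Finset (Set.powersetCard I d)) :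
    Option ((ℕ →₀ ℚ) × Finset ℕ) → Prop
  | none => ¬IsBlockFamily (S : Set (Set.powersetCard I d))
  | some w => IsBlockFamily (S : Set (Set.powersetCard I d)) ∧ Violates z S w

variable [Fintype ι] [DecidableEq (Set.powersetCard I d)] {s : ι → Set.powersetCard I d}

theorem violates_image_iff (hd : 0 < d) (hsep : Pairwise (Function.onFun Separated x))
    (hs : s ∈ selections d x) (w : (ℕ →₀ ℚ) × Finset ℕ) :
    Violates z (Finset.univ.image s) w ↔
      ‖∑ i, (w.1 (numPreceding x Finset.univ i) : ℝ) • z (s i)‖ + 1 <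
        ‖∑ i with numPreceding x Finset.univ i ∈ w.2,
          (w.1 (numPreceding x Finset.univ i) : ℝ) • z (s i)‖ := by
  have hinj : Set.InjOn s ↑(Finset.univ : Finset ι) :=
    (injective_of_mem_selections hd (hsep.mono fun _ _ => Separated.disjoint) hs).injOn
  simp only [Violates, Finset.sum_filter, Finset.sum_image hinj,
    numPreceding_image_selection hd hsep hs]

theorem norm_sum_le_of_forall_not_violates (hd : 0 < d) (hne : ∀ i, (x i).Nonempty)
    (hsep : Pairwise (Function.onFun Separated x)) (hs : s ∈ selections d x)
    (h : ∀ w, ¬Violates z (Finset.univ.image s) w) (G : Finset ι) (a : ι → ℝ) :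
    ‖∑ i ∈ G, a i • z (s i)‖ ≤ ‖∑ i, a i • z (s i)‖ := by
  classical
  refine norm_sum_le_norm_sum_of_forall_rat (C := 1) (fun b => ?_) a
  let pos : ι ↪ ℕ := ⟨numPreceding x Finset.univ, injective_numPreceding hne hsep⟩
  have hle := h (Finsupp.embDomain pos (Finsupp.equivFunOnFinite.symm b), G.map pos)
  rw [violates_image_iff hd hsep hs, not_lt] at hle
  have hcoeff : ∀ i, Finsupp.embDomain pos (Finsupp.equivFunOnFinite.symm b)
      (numPreceding x Finset.univ i) = b i := fun i => Finsupp.embDomain_apply_self pos _ i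
  have hset : ∀ i, numPreceding x Finset.univ i ∈ G.map pos ↔ i ∈ G := fun i =>
    Finset.mem_map' pos
  simpa only [hcoeff, hset, Finset.filter_univ_mem] using hle

end Violates

section LinearOrder

variable [LinearOrder I] [Fintype ι] [DecidableEq (Set.powersetCard I d)]
  {s : ι → Set.powersetCard I d}

theorem not_forall_isObstruction (hd : 2 ≤ d) (hz : IsWeaklySmall z) (hinf : ∀ i, (x i).Infinite)
    (hx : Pairwise (Function.onFun Disjoint x)) (o : Option ((ℕ →₀ ℚ) × Finset ℕ)) :
    ¬∀ s ∈ selections d x, IsObstruction z (Finset.univ.image s) o := by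
  intro h
  rcases o with _ | w
  · obtain ⟨s, hs, hblock⟩ := exists_mem_selections_isBlockFamily (two_pos.trans_le hd) hinf
    exact h s hs (by simpa using hblock)
  · have hsep := pairwise_separated_of_forall_isBlockFamily hd hinf hx fun s hs => by
      simpa using (h s hs).1
    obtain ⟨s, hs, hle⟩ := hz.exists_mem_selections_norm_sum_le hinf
      (fun i => (w.1 (numPreceding x Finset.univ i) : ℝ))
      {i | numPreceding x Finset.univ i ∈ w.2} one_pos
    exact ((violates_image_iff (by omega) hsep hs w).1 (h s hs).2).not_ge hle

theorem norm_sum_le_of_forall_not_isObstruction (hd : 2 ≤ d) (hinf : ∀ i, (x i).Infinite)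
    (hx : Pairwise (Function.onFun Disjoint x))
    (h : ∀ s ∈ selections d x, ∀ o, ¬IsObstruction z (Finset.univ.image s) o)
    (hs : s ∈ selections d x) (G : Finset ι) (a : ι → ℝ) :
    ‖∑ i ∈ G, a i • z (s i)‖ ≤ ‖∑ i, a i • z (s i)‖ := by
  have hblock : ∀ s ∈ selections d x,
      IsBlockFamily ((Finset.univ.image s : Finset _) : Set (Set.powersetCard I d)) :=
    fun s hs => not_not.1 (h s hs none)
  have hsep := pairwise_separated_of_forall_isBlockFamily hd hinf hx fun s hs => by
    simpa using hblock s hs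
  exact norm_sum_le_of_forall_not_violates (by omega) (fun i => (hinf i).nonempty) hsep hs
    (fun w hw => h s hs (some w) ⟨hblock s hs, hw⟩) G a

end LinearOrder

namespace PolarizedPartition

variable {κ : Cardinal.{u}}

theorem exists_uniform_or_forall_not (hκ : PolarizedPartition d κ) {W : Type*} [Countable W]
    [DecidableEq (Set.powersetCard κ.out d)]
    (P : Finset (Set.powersetCard κ.out d) → W → Prop) :
    ∃ x : ℕ → Set κ.out, (∀ n, (x n).Infinite) ∧ Pairwise (Function.onFun Disjoint x) ∧
      ∀ m : ℕ,
        (∃ w, ∀ s ∈ selections d fun i : Fin (m + 1) => x i, P (Finset.univ.image s) w) ∨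
        ∀ s ∈ selections d fun i : Fin (m + 1) => x i, ∀ w, ¬P (Finset.univ.image s) w := by
  classical
  obtain ⟨code, hcode⟩ := exists_injective_nat (Option W)
  have hwitness : ∀ S, ∃ o : Option W, o.elim (∀ w, ¬P S w) (P S) := fun S => by
    by_cases h : ∃ w, P S w
    · exact h.imp' some fun _ => id
    · exact ⟨none, not_exists.1 h⟩
  choose witness hwitness using hwitness
  obtain ⟨x, hinf, hdisj, hx⟩ := hκ fun S => code (witness S)
  refine ⟨x, hinf, hdisj, fun m => ?_⟩
  obtain ⟨k, hk⟩ := hx m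
  have hcolor : ∀ s ∈ selections d fun i : Fin (m + 1) => x i,
      code (witness (Finset.univ.image s)) = k := fun s hs => by convert hk s hs
  obtain ⟨s₀, hs₀⟩ := nonempty_selections d fun i : Fin (m + 1) => hinf i
  have hconst : ∀ s ∈ selections d fun i : Fin (m + 1) => x i,
      witness (Finset.univ.image s) = witness (Finset.univ.image s₀) := fun s hs =>
    hcode ((hcolor s hs).trans (hcolor s₀ hs₀).symm)
  rcases ho : witness (Finset.univ.image s₀) with _ | w
  · exact .inr fun s hs => by simpa [hconst s hs, ho] using hwitness (Finset.univ.image s)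
  · exact .inl ⟨w, fun s hs => by simpa [hconst s hs, ho] using hwitness (Finset.univ.image s)⟩

theorem exists_isUnconditionalWith_one (hκ : PolarizedPartition d κ) (hd : 2 ≤ d)
    {z : Set.powersetCard κ.out d → E} (hz : IsWeaklySmall z) :
    ∃ s : ℕ → Set.powersetCard κ.out d, IsUnconditionalWith 1 (z ∘ s) := by
  classical
  let _ : LinearOrder κ.out := IsWellOrder.linearOrder WellOrderingRel
  obtain ⟨x, hinf, hdisj, hx⟩ := hκ.exists_uniform_or_forall_not (IsObstruction z)
  obtain ⟨s, hs⟩ := nonempty_selections d hinf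
  refine ⟨s, isUnconditionalWith_of_forall_fin fun m G a => ?_⟩
  have hdisj' : Pairwise (Function.onFun Disjoint fun i : Fin (m + 1) => x i) :=
    hdisj.comp_of_injective Fin.val_injective
  have hnone := (hx m).resolve_left fun ⟨o, ho⟩ =>
    not_forall_isObstruction hd hz (fun i : Fin (m + 1) => hinf i) hdisj' o ho
  rw [one_mul]
  exact norm_sum_le_of_forall_not_isObstruction hd (fun i : Fin (m + 1) => hinf i) hdisj' hnone
    (fun i => hs i) G a

end PolarizedPartition

end Coloring

section Differences

variable {I : Type*} {d : ℕ}

theorem exists_infinite_subset_dist_lt {α : Type*} [PseudoMetricSpace α] {φ : I → α} {X : Set I}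
    (hX : X.Infinite) (hφ : TotallyBounded (φ '' X)) {ε : ℝ} (hε : 0 < ε) :
    ∃ Y ⊆ X, Y.Infinite ∧ ∀ a ∈ Y, ∀ b ∈ Y, dist (φ a) (φ b) < ε := by
  obtain ⟨centers, hfin, hcover⟩ := Metric.totallyBounded_iff.1 hφ (ε / 2) (half_pos hε)
  obtain ⟨c, -, hc⟩ : ∃ c ∈ centers, (X ∩ φ ⁻¹' Metric.ball c (ε / 2)).Infinite := by
    by_contra! h
    refine hX ((hfin.biUnion h).subset fun a ha => ?_)
    obtain ⟨c, hc, hac⟩ := Set.mem_iUnion₂.1 (hcover ⟨a, ha, rfl⟩)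
    exact Set.mem_biUnion hc ⟨ha, hac⟩
  refine ⟨_, Set.inter_subset_left, hc, fun a ha b hb => ?_⟩
  linarith [dist_triangle_right (φ a) (φ b) c, Metric.mem_ball.1 ha.2, Metric.mem_ball.1 hb.2]

theorem isWeaklySmall_sub {E : Type*} [NormedAddCommGroup E] [NormedSpace ℝ E] {e : I → E}
    (he : Bornology.IsBounded (Set.range e)) {p q : Set.powersetCard I d → I}
    (hp : ∀ t, p t ∈ t) (hq : ∀ t, q t ∈ t) : IsWeaklySmall fun t => e (p t) - e (q t) := by
  intro f X hX δ hδ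
  have htotally : TotallyBounded ((f ∘ e) '' X) :=
    (f.lipschitz.isBounded_image he).isCompact_closure.totallyBounded.subset <| by
      rw [Set.image_comp]
      exact (Set.image_mono (Set.image_subset_range e X)).trans subset_closure
  obtain ⟨Y, hYX, hY, hdist⟩ := exists_infinite_subset_dist_lt hX htotally hδ
  obtain ⟨t, -, ht⟩ := exists_powersetCard_between hY (A := ∅) (d := d) (by simp) (by simp)
  refine ⟨t, ht.trans hYX, ?_⟩
  rw [map_sub, ← Real.dist_eq]
  exact hdist _ (ht (hp t)) _ (ht (hq t))

theorem exists_injective_isBounded_range {α E : Type u} [NormedAddCommGroup E] [NormedSpace ℝ E]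
    (h : Cardinal.mk α ≤ Cardinal.mk E) :
    ∃ e : α → E, Function.Injective e ∧ Bornology.IsBounded (Set.range e) := by
  obtain ⟨g⟩ := h
  refine ⟨fun a => Homeomorph.unitBall (g a), ?_,
    (Metric.isBounded_ball (x := 0) (r := 1)).subset ?_⟩
  · exact Subtype.val_injective.comp (Homeomorph.unitBall.injective.comp g.injective)
  · exact Set.range_subset_iff.2 fun a => (Homeomorph.unitBall (g a)).2

end Differences

theorem densityCharacter_le_mk (E : Type u) [TopologicalSpace E] :
    densityCharacter E ≤ Cardinal.mk E :=
  csInf_le' ⟨Set.univ, dense_univ, Cardinal.mk_univ⟩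

theorem mainTheorem2_general {d : ℕ} (hd : 2 ≤ d) {κ : Cardinal.{u}} (hκ : PolarizedPartition d κ)
    (E : Type u) [NormedAddCommGroup E] [NormedSpace ℝ E] (hE : κ ≤ Cardinal.mk E) :
    HasUnconditionalBasicSequence E 1 := by
  obtain ⟨e, hinj, hbounded⟩ := exists_injective_isBounded_range (κ.mk_out.trans_le hE)
  have hnontrivial : ∀ t : Set.powersetCard κ.out d, ∃ a ∈ t, ∃ b ∈ t, a ≠ b := fun t =>
    Set.powersetCard.coe_nontrivial_iff.2 hd
  choose p hp q hq hpq using hnontrivial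
  obtain ⟨s, hs⟩ := hκ.exists_isUnconditionalWith_one hd (isWeaklySmall_sub hbounded hp hq)
  have hne : ∀ n, e (p (s n)) - e (q (s n)) ≠ 0 := fun n => sub_ne_zero.2 (hinj.ne (hpq (s n)))
  exact ⟨_, (hs.hasBasisConstant hne).isBasicSequence hne, hs⟩

theorem mainTheorem2 (κ : Cardinal.{u}) (hκ : PolarizedPartition 2 κ) :
    (∀ (E : Type u) [NormedAddCommGroup E] [NormedSpace ℝ E] [CompleteSpace E],
      densityCharacter E = κ → ¬ ContainsEllOne E → HasUnconditionalBasicSequence E 1) ∧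
    (∀ (E : Type u) [NormedAddCommGroup E] [NormedSpace ℝ E] [CompleteSpace E],
      densityCharacter E = κ → ∀ ε : ℝ, 0 < ε → HasUnconditionalBasicSequence E (1 + ε)) :=
  have hone (E : Type u) [NormedAddCommGroup E] [NormedSpace ℝ E] (hE : densityCharacter E = κ) :
      HasUnconditionalBasicSequence E 1 :=
    mainTheorem2_general le_rfl hκ E (hE ▸ densityCharacter_le_mk E)
  ⟨fun E _ _ _ hE _ => hone E hE, fun E _ _ _ hE _ hε => (hone E hE).mono (by linarith)⟩
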